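/- For a finite-dimensional real normed space $\mathbb M$, let its Borsuk number $b(\mathbb M)$ be the minimum $m\in\mathbb N$ such that every bounded subset $A$ of $\mathbb M$ with at least two points can be partitioned into $m$ (possibly empty) parts, each of diameter strictly smaller than the diameter of $A$. For real $p\ge 1$, let $\ell_p^d$ denote $\mathbb R^d$ with the norm $\|\mathbf x\|_p=\left(\sum_{i=1}^d|x_i|^p\right)^{1/p}$. Let $n,k\in\mathbb N$ and $p,\lambda\in\mathbb R$ be such that $1<k<n/2$, $p\ge 1$ and $-1/2\le\lambda\le 0$. Put $d=\binom n2$ and $$t_0=\frac{(3k-n)|\lambda|^p+k|1+\lambda|^p+(1/2-k)|1+2\lambda|^p}{2|\lambda|^p+2|1+\lambda|^p-|1+2\lambda|^p}.$$ Let $t_1$ be the largest integer with $t_1\le\lfloor t_0+1/2\rfloor$ such that $k-t_1$ is a prime power (that is, of the form $r^m$ with $r$ prime and $m\ge 1$, so primes are included and $1$ is not). If $0<t_1<k/2$, then $$b(\ell_p^d)\ \ge\ \binom nk\Big/\binom n{k-t_1-1}.$$ -/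

import Mathlib

/-- The set `A` can be partitioned into `m` (pairwise disjoint, possibly empty) parts, each of
diameter strictly smaller than that of `A`. -/
def HasBorsukPartition {E : Type*} [MetricSpace E] (A : Set E) (m : ℕ) : Prop :=
  ∃ P : Fin m → Set E, (⋃ i, P i) = A ∧ (∀ i j, i ≠ j → Disjoint (P i) (P j)) ∧
    ∀ i, Metric.diam (P i) < Metric.diam A

/-- The Borsuk number: the minimum `m` such that every bounded set with at least two points can be
partitioned into `m` parts of smaller diameter. For finite-dimensional real normed spaces such an
`m` exists, see `exists_hasBorsukPartition`, so this is a genuine minimum. -/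
noncomputable def borsukNumber (E : Type*) [MetricSpace E] : ℕ :=
  sInf {m : ℕ | ∀ A : Set E, Bornology.IsBounded A → A.Nontrivial → HasBorsukPartition A m}

/-- The set whose infimum is the Borsuk number is nonempty for finite-dimensional spaces. -/
theorem exists_hasBorsukPartition (E : Type*) [NormedAddCommGroup E] [NormedSpace ℝ E]
    [FiniteDimensional ℝ E] :
    ∃ m : ℕ, ∀ A : Set E, Bornology.IsBounded A → A.Nontrivial → HasBorsukPartition A m := by
  have : ProperSpace E := FiniteDimensional.proper ℝ E
  obtain ⟨s, hsf, hs⟩ := Metric.totallyBounded_iff.1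
    (isCompact_closedBall (0 : E) 1).totallyBounded (1 / 4) (by norm_num)
  have : Finite s := hsf
  let e := Finite.equivFin s
  refine ⟨Nat.card s, fun A hA hA2 => ?_⟩
  obtain ⟨a, ha, b, hb, hab⟩ := hA2
  have hD : 0 < Metric.diam A :=
    lt_of_lt_of_le (dist_pos.2 hab) (Metric.dist_le_diam_of_mem hA ha hb)
  set D := Metric.diam A with hDdef
  let B : Fin (Nat.card s) → Set E := fun i =>
    {x | x ∈ A ∧ D⁻¹ • (x - a) ∈ Metric.ball ((e.symm i : s) : E) (1 / 4)}
  refine ⟨disjointed B, ?_, fun i j hij => disjoint_disjointed B hij, fun i => ?_⟩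
  · rw [iUnion_disjointed]
    ext x
    simp only [Set.mem_iUnion]
    constructor
    · rintro ⟨i, hi⟩
      exact hi.1
    · intro hx
      have hmem : D⁻¹ • (x - a) ∈ Metric.closedBall (0 : E) 1 := by
        rw [mem_closedBall_zero_iff, norm_smul, norm_inv, Real.norm_of_nonneg hD.le,
          ← dist_eq_norm, inv_mul_le_iff₀ hD, mul_one]
        exact Metric.dist_le_diam_of_mem hA hx ha
      obtain ⟨y, hy, hxy⟩ := Set.mem_iUnion₂.1 (hs hmem)
      refine ⟨e ⟨y, hy⟩, hx, ?_⟩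
      rw [Equiv.symm_apply_apply]
      exact hxy
  · refine lt_of_le_of_lt (Metric.diam_le_of_forall_dist_le (C := D / 2) (by positivity) ?_)
      (by linarith)
    intro x hx y hy
    have h1 := (disjointed_subset B i hx).2
    have h2 := (disjointed_subset B i hy).2
    have h3 := dist_triangle_right (D⁻¹ • (x - a)) (D⁻¹ • (y - a)) ((e.symm i : s) : E)
    rw [dist_smul₀, dist_sub_right, norm_inv, Real.norm_of_nonneg hD.le] at h3
    rw [Metric.mem_ball] at h1 h2
    have h4 : D⁻¹ * dist x y ≤ 1 / 2 := by linarith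
    rw [inv_mul_le_iff₀ hD] at h4
    linarith

/-- The Borsuk number of `ℓ_p^d`, that is, of `ℝ^d` with the `ℓ_p`-norm, for real `p ≥ 1`. -/
noncomputable def borsukNumberLp (p : ℝ) (hp : 1 ≤ p) (d : ℕ) : ℕ :=
  haveI : Fact (1 ≤ ENNReal.ofReal p) := ⟨ENNReal.one_le_ofReal.2 hp⟩
  borsukNumber (PiLp (ENNReal.ofReal p) (fun _ : Fin d => ℝ))

/-- The real number `t₀`; the denominator is positive when `p ≥ 1` and `-1/2 ≤ lam ≤ 0`. -/
noncomputable def tZero (lam p : ℝ) (n k : ℕ) : ℝ :=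
  ((3 * (k : ℝ) - n) * |lam| ^ p + k * |1 + lam| ^ p + (1 / 2 - (k : ℝ)) * |1 + 2 * lam| ^ p) /
    (2 * |lam| ^ p + 2 * |1 + lam| ^ p - |1 + 2 * lam| ^ p)

/-! Map each `k`-subset of an `n`-set to the point of `ℓ_p^d` whose coordinate at a pair is `0`,
`lam` or `1 + 2 * lam`, according to how many elements of the pair lie in the subset. The `p`-th
power of the distance of two such points is a concave quadratic in the intersection size, with
vertex `tZero` (`distQuadratic_sub`), so an integer `t` within `1 / 2` of the vertex realises the
diameter. If `t` lies further below, the parameter is moved towards `0` until the vertex equals `t`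
(`exists_abs_sub_tZero_le`). A part of smaller diameter then contains no two sets meeting in `t`
elements. As `k - t` is a prime power `q > t`, the Frankl–Wilson bound
(`card_le_choose_of_inter_ne`) allows it at most `n.choose (q - 1)` sets, and dividing gives the
theorem. -/

/-! ### The Frankl–Wilson bound by a rank argument -/

section FranklWilson

open Finset

/-- In the Vandermonde expansion over `q = r ^ e` and `v`, the term taking nothing from `q` vanishes
by size; the others contain `q.choose i` with `0 < i < q`. -/
theorem prime_dvd_choose_of_prime_pow {r e v : ℕ} (hr : r.Prime) (hv : v + 1 < r ^ e) :
    r ∣ (r ^ e + v).choose (r ^ e - 1) := by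
  rw [Nat.add_choose_eq]
  refine Finset.dvd_sum fun ij hij => ?_
  rw [Finset.HasAntidiagonal.mem_antidiagonal] at hij
  rcases Nat.eq_zero_or_pos ij.1 with h0 | h0
  · rw [Nat.choose_eq_zero_of_lt (n := v) (by omega), mul_zero]
    exact dvd_zero _
  · exact (hr.dvd_choose_pow (by omega) (by omega)).mul_right _

theorem choose_two_mul_prime_pow_sub_one_modEq {r e : ℕ} (hr : r.Prime) :
    ((r ^ e + (r ^ e - 1)).choose (r ^ e - 1) : ZMod r) = 1 := by
  have hpos : 0 < r ^ e := pow_pos hr.pos e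
  rw [Nat.add_choose_eq, Nat.cast_sum,
    Finset.sum_eq_single (0, r ^ e - 1)]
  · simp
  · intro ij hij hne
    rw [Finset.HasAntidiagonal.mem_antidiagonal] at hij
    rw [ZMod.natCast_eq_zero_iff]
    have h0 : ij.1 ≠ 0 := fun h => hne (Prod.ext h (by simp only; omega))
    exact (hr.dvd_choose_pow h0 (by omega)).mul_right _
  · intro h
    simp at h

variable {α : Type*} [Fintype α] [DecidableEq α]

theorem sum_powersetCard_subset_indicator {R : Type*} [Semiring R] (X : Finset α) (i : ℕ) :
    ∑ I ∈ powersetCard i (univ : Finset α), (if I ⊆ X then (1 : R) else 0) = (#X).choose i := by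
  rw [Finset.sum_boole, ← card_powersetCard]
  congr 2
  ext I
  simp [mem_powersetCard, and_comm]

theorem card_filter_subset_subset {I S : Finset α} (hIS : I ⊆ S) {j : ℕ} (hj : #I ≤ j) :
    #{J ∈ powersetCard j (univ : Finset α) | I ⊆ J ∧ J ⊆ S} = (#S - #I).choose (j - #I) := by
  rw [← card_sdiff_of_subset hIS, ← card_powersetCard]
  refine card_bij' (fun J _ => J \ I) (fun K _ => K ∪ I) ?_ ?_ ?_ ?_
  · intro J hJ
    simp only [mem_filter, mem_powersetCard, subset_univ, true_and] at hJ ⊢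
    refine ⟨sdiff_subset_sdiff hJ.2.2 le_rfl, ?_⟩
    rw [card_sdiff_of_subset hJ.2.1, hJ.1]
  · intro K hK
    simp only [mem_filter, mem_powersetCard, subset_univ, true_and] at hK ⊢
    have hd : Disjoint K I := disjoint_of_subset_left hK.1 sdiff_disjoint
    refine ⟨?_, subset_union_right, union_subset (hK.1.trans sdiff_subset) hIS⟩
    rw [card_union_of_disjoint hd, hK.2]
    omega
  · intro J hJ
    simp only [mem_filter] at hJ
    exact sdiff_union_of_subset hJ.2.1
  · intro K hK
    simp only [mem_powersetCard] at hK
    have hd : Disjoint K I := disjoint_of_subset_left hK.1 sdiff_disjoint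
    rw [union_sdiff_right, sdiff_eq_self_of_disjoint hd]

/-- The inclusion matrix of `i`-sets factors through that of `j`-sets over `ℚ`. -/
theorem subset_indicator_eq_sum {I S : Finset α} {j : ℕ} (hI : #I ≤ j) (hj : j ≤ #S) :
    (if I ⊆ S then (1 : ℚ) else 0) =
      ((#S - #I).choose (j - #I) : ℚ)⁻¹ * ∑ J ∈ powersetCard j (univ : Finset α),
        (if I ⊆ J then 1 else 0) * (if J ⊆ S then 1 else 0) := by
  have hc : ((#S - #I).choose (j - #I) : ℚ) ≠ 0 := by
    exact_mod_cast (Nat.choose_pos (by omega)).ne'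
  rw [eq_inv_mul_iff_mul_eq₀ hc]
  split_ifs with h
  · rw [mul_one, ← card_filter_subset_subset h hI, ← Finset.sum_boole]
    refine sum_congr rfl fun J _ => ?_
    by_cases h1 : I ⊆ J <;> by_cases h2 : J ⊆ S <;> simp [h1, h2]
  · rw [mul_zero, eq_comm]
    refine sum_eq_zero fun J _ => ?_
    by_cases h1 : I ⊆ J <;> by_cases h2 : J ⊆ S <;> simp [h1, h2]
    exact h (h1.trans h2)

/-- Vandermonde's identity reduces to counting the `i`-sets inside both `S` and `T`; each condition
`I ⊆ S` is then lifted to `j`-sets. For fixed `#S`, the set `S` enters only through `J ⊆ S`, which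
makes this a matrix factorisation through the `j`-sets. -/
theorem choose_card_inter_add_eq_sum {S T : Finset α} {j c : ℕ} (hS : j ≤ #S) :
    ((#(S ∩ T) + c).choose j : ℚ) = ∑ J ∈ powersetCard j (univ : Finset α),
      (if J ⊆ S then 1 else 0) * ∑ i ∈ range (j + 1), (c.choose (j - i) : ℚ) *
        ∑ I ∈ powersetCard i (univ : Finset α), ((#S - i).choose (j - i) : ℚ)⁻¹ *
          (if I ⊆ J then 1 else 0) * (if I ⊆ T then 1 else 0) := by
  rw [Nat.add_choose_eq, Nat.sum_antidiagonal_eq_sum_range_succ_mk, Nat.cast_sum]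
  simp_rw [mul_sum]
  rw [sum_comm]
  refine sum_congr rfl fun i hi => ?_
  rw [sum_comm, Nat.cast_mul, ← sum_powersetCard_subset_indicator, sum_mul]
  refine sum_congr rfl fun I hI => ?_
  have hIi : #I = i := (mem_powersetCard.1 hI).2
  have hij : #I ≤ j := by rw [mem_range] at hi; omega
  have h1 : (if I ⊆ S ∩ T then (1 : ℚ) else 0) =
      (if I ⊆ S then 1 else 0) * (if I ⊆ T then 1 else 0) := by
    by_cases h1 : I ⊆ S <;> by_cases h2 : I ⊆ T <;> simp [subset_inter_iff, h1, h2]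
  rw [h1, subset_indicator_eq_sum hij hS, hIi, mul_sum, sum_mul, sum_mul]
  refine sum_congr rfl fun J _ => ?_
  ring

/-- The Frankl–Wilson bound for uniform families avoiding one intersection size. -/
theorem card_le_choose_of_inter_ne {k t r e : ℕ} (hr : r.Prime) (hkt : k = t + r ^ e)
    (ht : t < r ^ e) (F : Finset (Finset α)) (hF : ∀ S ∈ F, #S = k)
    (hne : ∀ S ∈ F, ∀ T ∈ F, #(S ∩ T) ≠ t) :
    #F ≤ (Fintype.card α).choose (r ^ e - 1) := by
  have : Fact r.Prime := ⟨hr⟩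
  set q := r ^ e with hq
  -- The shift `q - 1 - t` sends `k` to `2 * q - 1` and the forbidden size `t` to `q - 1`; the
  -- entries for all other sizes below `k` are divisible by `r`.
  let M : Matrix F F ℤ :=
    Matrix.of fun S T => ((#(S.1 ∩ T.1) + (q - 1 - t)).choose (q - 1) : ℕ)
  have hmod : M.map (Int.castRingHom (ZMod r)) = 1 := by
    ext S T
    simp only [Matrix.map_apply, M, Matrix.of_apply, eq_intCast, Int.cast_natCast]
    by_cases hST : S = T
    · subst hST
      rw [inter_self, hF _ S.2, Matrix.one_apply_eq,
        show k + (q - 1 - t) = q + (q - 1) by omega]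
      exact choose_two_mul_prime_pow_sub_one_modEq hr
    · rw [Matrix.one_apply_ne hST, ZMod.natCast_eq_zero_iff]
      have hlt : #(S.1 ∩ T.1) < k := by
        rw [← hF _ S.2]
        refine card_lt_card (Finset.ssubset_iff_subset_ne.2 ⟨inter_subset_left, fun h => hST ?_⟩)
        refine Subtype.ext (eq_of_subset_of_card_le (inter_eq_left.1 h) ?_)
        rw [hF _ S.2, hF _ T.2]
      have hst := hne _ S.2 _ T.2
      rcases lt_or_gt_of_ne hst with h | h
      · rw [Nat.choose_eq_zero_of_lt (by omega)]
        exact dvd_zero _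
      · rw [show #(S.1 ∩ T.1) + (q - 1 - t) = q + (#(S.1 ∩ T.1) - t - 1) by omega]
        exact prime_dvd_choose_of_prime_pow hr (by omega)
  have hdet : M.det ≠ 0 := by
    intro h
    have h1 := (Int.castRingHom (ZMod r)).map_det M
    rw [h, RingHom.mapMatrix_apply, hmod, Matrix.det_one, map_zero] at h1
    exact zero_ne_one h1
  -- The integer determinant carries nonsingularity from characteristic `r` to `ℚ`, where the
  -- binomials in the factorisation can be inverted.
  let N : Matrix F F ℚ := M.map (Int.castRingHom ℚ)
  have hdetN : N.det ≠ 0 := by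
    have h1 := (Int.castRingHom ℚ).map_det M
    rw [RingHom.mapMatrix_apply] at h1
    change (M.map (Int.castRingHom ℚ)).det ≠ 0
    rw [← h1]
    simpa using hdet
  let A : Matrix F (powersetCard (q - 1) (univ : Finset α)) ℚ :=
    fun S J => if J.1 ⊆ S.1 then 1 else 0
  let B : Matrix (powersetCard (q - 1) (univ : Finset α)) F ℚ :=
    fun J T => ∑ i ∈ range (q - 1 + 1), ((q - 1 - t).choose (q - 1 - i) : ℚ) *
        ∑ I ∈ powersetCard i (univ : Finset α), ((k - i).choose (q - 1 - i) : ℚ)⁻¹ *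
          (if I ⊆ J.1 then 1 else 0) * (if I ⊆ T.1 then 1 else 0)
  have hN : N = A * B := by
    ext S T
    have hS := hF _ S.2
    have h := choose_card_inter_add_eq_sum (S := S.1) (T := T.1) (j := q - 1) (c := q - 1 - t)
      (by omega)
    rw [hS] at h
    simp only [N, M, Matrix.map_apply, Matrix.of_apply, eq_intCast, Int.cast_natCast]
    rw [h, ← Finset.sum_coe_sort]
    rfl
  have hrank : N.rank = Fintype.card F :=
    Matrix.rank_of_isUnit N ((Matrix.isUnit_iff_isUnit_det N).2 hdetN.isUnit)
  have hle : N.rank ≤ Fintype.card (powersetCard (q - 1) (univ : Finset α)) := by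
    rw [hN]
    exact (Matrix.rank_mul_le_left A B).trans (Matrix.rank_le_card_width A)
  rw [hrank, Fintype.card_coe, Fintype.card_coe, card_powersetCard, card_univ] at hle
  exact hle

end FranklWilson

/-! ### Distances between embedded `k`-sets -/

section Embedding

open Finset

variable {α : Type*} [Fintype α] [DecidableEq α]

theorem sum_powersetCard_two_choose_inter (X : Finset α) :
    ∑ P ∈ powersetCard 2 (univ : Finset α), ((#(P ∩ X)).choose 2 : ℝ) = (#X).choose 2 := by
  rw [← sum_powersetCard_subset_indicator]
  refine sum_congr rfl fun P hP => ?_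
  have hP2 : #P = 2 := (mem_powersetCard.1 hP).2
  split_ifs with h
  · rw [inter_eq_left.2 h, hP2]
    simp
  · have hlt : #(P ∩ X) < 2 := by
      rw [← hP2]
      exact card_lt_card (Finset.ssubset_iff_subset_ne.2 ⟨inter_subset_left, fun h' =>
        h (inter_eq_left.1 h')⟩)
    rw [Nat.choose_eq_zero_of_lt hlt, Nat.cast_zero]

/-- Polarisation: `x * y` is `(x + y).choose 2 - x.choose 2 - y.choose 2`. -/
theorem sum_powersetCard_two_card_inter_mul {X Y : Finset α} (h : Disjoint X Y) :
    ∑ P ∈ powersetCard 2 (univ : Finset α), (#(P ∩ X) : ℝ) * #(P ∩ Y) = #X * #Y := by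
  have key (P : Finset α) : (#(P ∩ X) : ℝ) * #(P ∩ Y) =
      (#(P ∩ (X ∪ Y))).choose 2 - (#(P ∩ X)).choose 2 - (#(P ∩ Y)).choose 2 := by
    rw [inter_union_distrib_left, card_union_of_disjoint
      (disjoint_of_subset_left inter_subset_right (disjoint_of_subset_right inter_subset_right h))]
    simp only [Nat.cast_choose_two, Nat.cast_add]
    ring
  simp_rw [key, sum_sub_distrib, sum_powersetCard_two_choose_inter]
  rw [card_union_of_disjoint h]
  simp only [Nat.cast_choose_two, Nat.cast_add]
  ring

/-- The value at a pair meeting a set in `m` elements: `0`, `lam`, `1 + 2 * lam`. -/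
noncomputable def pairValue (lam : ℝ) (m : ℕ) : ℝ := lam * m + (m.choose 2 : ℕ)

/-- Here `a`, `b`, `c`, `d` count the elements of a pair in `S \ T`, `T \ S`, `S ∩ T` and outside `S
∪ T`. A pair of type `a = b = 1` has equal values for both sets, hence no `a * b` term. -/
theorem abs_pairValue_sub_rpow {lam p : ℝ} (hp : p ≠ 0) {a b c d : ℕ} (h : a + b + c + d = 2) :
    |pairValue lam (a + c) - pairValue lam (b + c)| ^ p =
      |1 + 2 * lam| ^ p * ((a.choose 2 : ℕ) + (b.choose 2 : ℕ)) +
      |1 + lam| ^ p * (a * c + b * c) + |lam| ^ p * (a * d + b * d) := by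
  have e1 : |lam * 2 + 1| = |1 + 2 * lam| := by ring_nf
  have e2 : |-1 + -(lam * 2)| = |1 + 2 * lam| := by
    rw [← abs_neg (1 + 2 * lam)]; ring_nf
  have e3 : |lam * 2 + 1 - lam| = |1 + lam| := by ring_nf
  have e4 : |lam - (lam * 2 + 1)| = |1 + lam| := by
    rw [← abs_neg (1 + lam)]; ring_nf
  have ha : a ≤ 2 := by omega
  have hb : b ≤ 2 := by omega
  have hc : c ≤ 2 := by omega
  obtain rfl : d = 2 - a - b - c := by omega
  interval_cases a <;> interval_cases b <;> interval_cases c <;>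
    first
    | omega
    | simp [pairValue, Real.zero_rpow hp, e1, e2, e3, e4]

/-- Half the `p`-th power of the distance of two points whose `k`-sets meet in `t` elements. -/
noncomputable def distQuadratic (lam p : ℝ) (n k : ℕ) (t : ℝ) : ℝ :=
  (k - t) * (|1 + 2 * lam| ^ p * ((k - t - 1) / 2) + |1 + lam| ^ p * t +
    |lam| ^ p * (n - 2 * k + t))

theorem sum_abs_pairValue_sub_rpow {lam p : ℝ} (hp : p ≠ 0) {k : ℕ} {S T : Finset α}
    (hS : #S = k) (hT : #T = k) :
    ∑ P ∈ powersetCard 2 (univ : Finset α),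
      |pairValue lam #(P ∩ S) - pairValue lam #(P ∩ T)| ^ p =
      2 * distQuadratic lam p (Fintype.card α) k #(S ∩ T) := by
  have hX := card_sdiff_add_card_inter S T
  have hY := card_sdiff_add_card_inter T S
  have hST := card_union_add_card_inter S T
  have hZ := card_compl_add_card (S ∪ T)
  rw [inter_comm T S] at hY
  have d1 : Disjoint (S \ T) (S ∩ T) := disjoint_sdiff_inter S T
  have d2 : Disjoint (T \ S) (S ∩ T) := inter_comm T S ▸ disjoint_sdiff_inter T S
  have d3 : Disjoint (S \ T) (S ∪ T)ᶜ :=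
    disjoint_compl_right.mono_left (sdiff_subset.trans subset_union_left)
  have d4 : Disjoint (T \ S) (S ∪ T)ᶜ :=
    disjoint_compl_right.mono_left (sdiff_subset.trans subset_union_right)
  have key : ∀ P ∈ powersetCard 2 (univ : Finset α),
      |pairValue lam #(P ∩ S) - pairValue lam #(P ∩ T)| ^ p =
      |1 + 2 * lam| ^ p * ((#(P ∩ (S \ T))).choose 2 + (#(P ∩ (T \ S))).choose 2) +
      |1 + lam| ^ p * (#(P ∩ (S \ T)) * #(P ∩ (S ∩ T)) + #(P ∩ (T \ S)) * #(P ∩ (S ∩ T))) +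
      |lam| ^ p * (#(P ∩ (S \ T)) * #(P ∩ (S ∪ T)ᶜ) + #(P ∩ (T \ S)) * #(P ∩ (S ∪ T)ᶜ)) := by
    intro P hP
    have hP2 : #P = 2 := (mem_powersetCard.1 hP).2
    have inter_split {X Y : Finset α} (h : Disjoint X Y) :
        #(P ∩ (X ∪ Y)) = #(P ∩ X) + #(P ∩ Y) := by
      rw [inter_union_distrib_left, card_union_of_disjoint
        (h.mono inter_subset_right inter_subset_right)]
    have hs : #(P ∩ S) = #(P ∩ (S \ T)) + #(P ∩ (S ∩ T)) := by
      rw [← inter_split d1, sdiff_union_inter]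
    have ht : #(P ∩ T) = #(P ∩ (T \ S)) + #(P ∩ (S ∩ T)) := by
      rw [← inter_split d2, inter_comm S T, sdiff_union_inter]
    have hu : #(P ∩ (S ∪ T)) = #(P ∩ (S \ T)) + #(P ∩ T) := by
      rw [← inter_split sdiff_disjoint, sdiff_union_self_eq_union]
    have hall : #(P ∩ (S ∪ T)) + #(P ∩ (S ∪ T)ᶜ) = 2 := by
      rw [← inter_split disjoint_compl_right, union_compl, inter_univ, hP2]
    rw [hs, ht]
    exact abs_pairValue_sub_rpow hp (by omega)
  rw [sum_congr rfl key]
  simp only [sum_add_distrib, ← mul_sum, sum_powersetCard_two_choose_inter,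
    sum_powersetCard_two_card_inter_mul d1, sum_powersetCard_two_card_inter_mul d2,
    sum_powersetCard_two_card_inter_mul d3, sum_powersetCard_two_card_inter_mul d4]
  have cX : (#(S \ T) : ℝ) = k - #(S ∩ T) := by rw [← hS, ← hX]; push_cast; ring
  have cY : (#(T \ S) : ℝ) = k - #(S ∩ T) := by rw [← hT, ← hY]; push_cast; ring
  have cZ : (#(S ∪ T)ᶜ : ℝ) = Fintype.card α - 2 * k + #(S ∩ T) := by
    have h1 : (#(S ∪ T) : ℝ) + #(S ∩ T) = k + k := by rw [hS, hT] at hST; exact_mod_cast hST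
    have h2 : (#(S ∪ T)ᶜ : ℝ) + #(S ∪ T) = Fintype.card α := by exact_mod_cast hZ
    linarith
  rw [Nat.cast_choose_two, Nat.cast_choose_two, cX, cY, cZ, distQuadratic]
  ring

/-! ### The vertex of the quadratic and the choice of parameter -/

theorem denominator_pos {lam p : ℝ} (hp : 0 ≤ p) (hlam : -1 / 2 ≤ lam) (hlam' : lam ≤ 0) :
    0 < 2 * |lam| ^ p + 2 * |1 + lam| ^ p - |1 + 2 * lam| ^ p := by
  rw [abs_of_pos (show 0 < 1 + lam by linarith), abs_of_nonneg (show 0 ≤ 1 + 2 * lam by linarith)]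
  have h1 : 0 ≤ |lam| ^ p := by positivity
  have h2 : 0 < (1 + lam) ^ p := Real.rpow_pos_of_pos (by linarith) p
  have h3 : (1 + 2 * lam) ^ p ≤ (1 + lam) ^ p :=
    Real.rpow_le_rpow (by linarith) (by linarith) hp
  linarith

/-- Completing the square: the leading coefficient is minus half the denominator of `tZero`. -/
theorem distQuadratic_sub {lam p : ℝ} (hp : 0 ≤ p) (hlam : -1 / 2 ≤ lam) (hlam' : lam ≤ 0)
    (n k : ℕ) (s t : ℝ) :
    distQuadratic lam p n k s - distQuadratic lam p n k t =
      (2 * |lam| ^ p + 2 * |1 + lam| ^ p - |1 + 2 * lam| ^ p) / 2 *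
        ((t - tZero lam p n k) ^ 2 - (s - tZero lam p n k) ^ 2) := by
  have hD := (denominator_pos hp hlam hlam').ne'
  have h : tZero lam p n k * (2 * |lam| ^ p + 2 * |1 + lam| ^ p - |1 + 2 * lam| ^ p) =
      (3 * (k : ℝ) - n) * |lam| ^ p + k * |1 + lam| ^ p + (1 / 2 - (k : ℝ)) * |1 + 2 * lam| ^ p :=
    div_mul_cancel₀ _ hD
  unfold distQuadratic
  linear_combination (s - t) * (-1) * h

/-- Integers within `1 / 2` of the vertex maximise the distance. -/
theorem distQuadratic_le {lam p : ℝ} (hp : 0 ≤ p) (hlam : -1 / 2 ≤ lam) (hlam' : lam ≤ 0)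
    {n k s t : ℕ} (ht : |(t : ℝ) - tZero lam p n k| ≤ 1 / 2) :
    distQuadratic lam p n k s ≤ distQuadratic lam p n k t := by
  rw [← sub_nonneg, distQuadratic_sub hp hlam hlam']
  refine mul_nonneg (by linarith [denominator_pos hp hlam hlam']) (sub_nonneg.2 ?_)
  rcases eq_or_ne s t with rfl | hst
  · exact le_rfl
  -- Another integer is at least `1` from `t`, hence at least `1 / 2` from the vertex.
  · have h1 : (1 : ℝ) ≤ |(s : ℝ) - t| := by
      have : (1 : ℤ) ≤ |(s : ℤ) - t| := Int.one_le_abs (by omega)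
      exact_mod_cast this
    refine sq_le_sq.2 (ht.trans ?_)
    have h2 := abs_sub_abs_le_abs_sub ((s : ℝ) - t) (tZero lam p n k - t)
    rw [abs_sub_comm (tZero lam p n k), sub_sub_sub_cancel_right] at h2
    linarith

theorem distQuadratic_pos {lam p : ℝ} (hlam : -1 / 2 ≤ lam) {n k t : ℕ} (hn : 2 * k ≤ n) (htk : t < k) (ht : 0 < t) :
    0 < distQuadratic lam p n k t := by
  have h1 : (t : ℝ) + 1 ≤ k := by exact_mod_cast htk
  have h2 : (2 : ℝ) * k ≤ n := by exact_mod_cast hn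
  have h3 : (0 : ℝ) < t := by exact_mod_cast ht
  have h4 : 0 < |1 + lam| ^ p := Real.rpow_pos_of_pos (abs_pos.2 (by linarith)) p
  unfold distQuadratic
  refine mul_pos (by linarith) ?_
  have h5 : 0 ≤ |1 + 2 * lam| ^ p * ((k - t - 1) / 2) :=
    mul_nonneg (by positivity) (by linarith)
  have h6 : 0 ≤ |lam| ^ p * (n - 2 * k + t) := mul_nonneg (by positivity) (by linarith)
  have h7 := mul_pos h4 h3
  linarith

/-- The vertex at `0` lies below every positive integer, which supplies the lower end for the
intermediate value theorem. -/
theorem tZero_zero {p : ℝ} (hp : p ≠ 0) (n k : ℕ) : tZero 0 p n k = 1 / 2 := by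
  simp only [tZero, abs_zero, Real.zero_rpow hp, add_zero, mul_zero, abs_one, Real.one_rpow]
  ring

theorem continuousOn_tZero {p : ℝ} (hp : 0 ≤ p) (n k : ℕ) :
    ContinuousOn (fun lam => tZero lam p n k) (Set.Icc (-1 / 2) 0) := by
  have hc (f : ℝ → ℝ) (hf : Continuous f) : Continuous fun lam => |f lam| ^ p :=
    hf.abs.rpow_const fun _ => Or.inr hp
  have h1 := hc (fun lam => lam) (by fun_prop)
  have h2 := hc (fun lam => 1 + lam) (by fun_prop)
  have h3 := hc (fun lam => 1 + 2 * lam) (by fun_prop)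
  unfold tZero
  refine ContinuousOn.div (Continuous.continuousOn (by fun_prop))
    (Continuous.continuousOn (by fun_prop)) fun lam hlam => ?_
  exact (denominator_pos hp hlam.1 hlam.2).ne'

/-- Any positive integer not exceeding `tZero + 1 / 2` is a nearest integer to `tZero` for some
other parameter. -/
theorem exists_abs_sub_tZero_le {lam p : ℝ} (hp : 0 < p) (hlam : -1 / 2 ≤ lam) (hlam' : lam ≤ 0)
    {n k t : ℕ} (ht : 0 < t) (hle : (t : ℝ) ≤ tZero lam p n k + 1 / 2) :
    ∃ mu, -1 / 2 ≤ mu ∧ mu ≤ 0 ∧ |(t : ℝ) - tZero mu p n k| ≤ 1 / 2 := by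
  rcases le_or_gt (t : ℝ) (tZero lam p n k) with h | h
  · have h1 : (1 : ℝ) ≤ t := by exact_mod_cast ht
    have hsub : Set.Icc lam 0 ⊆ Set.Icc (-1 / 2 : ℝ) 0 := Set.Icc_subset_Icc_left hlam
    obtain ⟨mu, hmu, hmut⟩ := intermediate_value_Icc' hlam'
      ((continuousOn_tZero hp.le n k).mono hsub)
      (show (t : ℝ) ∈ Set.Icc (tZero 0 p n k) (tZero lam p n k) from
        ⟨by rw [tZero_zero hp.ne']; linarith, h⟩)
    simp only at hmut
    refine ⟨mu, (hsub hmu).1, hmu.2, ?_⟩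
    rw [hmut, sub_self, abs_zero]
    norm_num
  · exact ⟨lam, hlam, hlam', abs_le.2 ⟨by linarith, by linarith⟩⟩

theorem exists_card_inter_eq {k t : ℕ} (htk : t ≤ k) (hn : 2 * k ≤ Fintype.card α) :
    ∃ S T : Finset α, #S = k ∧ #T = k ∧ #(S ∩ T) = t := by
  obtain ⟨S, -, hS⟩ := exists_subset_card_eq (s := (univ : Finset α)) (n := k)
    (by rw [card_univ]; omega)
  obtain ⟨U, hU, hUt⟩ := exists_subset_card_eq (s := S) (n := t) (by omega)
  obtain ⟨V, hV, hVt⟩ := exists_subset_card_eq (s := Sᶜ) (n := k - t) (by rw [card_compl]; omega)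
  have hSV : Disjoint S V := disjoint_of_subset_right hV disjoint_compl_right
  refine ⟨S, U ∪ V, hS, ?_, ?_⟩
  · rw [card_union_of_disjoint (disjoint_of_subset_left hU hSV), hUt, hVt]
    omega
  · rw [inter_union_distrib_left, disjoint_iff_inter_eq_empty.1 hSV, union_empty,
      inter_eq_right.2 hU, hUt]

end Embedding

/-! ### From families of sets to Borsuk partitions -/

section Borsuk

open Finset

/-- The pairs of elements of `Fin n`, enumerated. -/
noncomputable def pairsEquiv (n : ℕ) :
    Fin (n.choose 2) ≃ powersetCard 2 (univ : Finset (Fin n)) :=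
  (Finset.equivFinOfCardEq (by simp)).symm

noncomputable def setPoint (lam : ℝ) (r : ENNReal) {n : ℕ} (S : Finset (Fin n)) :
    PiLp r (fun _ : Fin (n.choose 2) => ℝ) :=
  WithLp.toLp r fun i => pairValue lam #((pairsEquiv n i).1 ∩ S)

theorem dist_setPoint {p : ℝ} (hp : 0 < p) [Fact (1 ≤ ENNReal.ofReal p)] (lam : ℝ) {n k : ℕ}
    {S T : Finset (Fin n)} (hS : #S = k) (hT : #T = k) :
    dist (setPoint lam (ENNReal.ofReal p) S) (setPoint lam (ENNReal.ofReal p) T) =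
      (2 * distQuadratic lam p n k #(S ∩ T)) ^ (1 / p) := by
  have htr : (ENNReal.ofReal p).toReal = p := ENNReal.toReal_ofReal hp.le
  rw [PiLp.dist_eq_sum (by rw [htr]; exact hp), htr]
  congr 1
  have h := sum_abs_pairValue_sub_rpow (lam := lam) hp.ne' hS hT
  rw [Fintype.card_fin] at h
  rw [← h]
  exact (Fintype.sum_equiv (pairsEquiv n) _
    (fun P => |pairValue lam #(P.1 ∩ S) - pairValue lam #(P.1 ∩ T)| ^ p) fun i => rfl).trans
    (Finset.sum_coe_sort (powersetCard 2 univ)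
      fun P => |pairValue lam #(P ∩ S) - pairValue lam #(P ∩ T)| ^ p)

theorem choose_le_mul_of_hasBorsukPartition {E : Type*} [MetricSpace E] {n k t r e m : ℕ}
    (hr : r.Prime) (hkt : k = t + r ^ e) (ht : t < r ^ e) (x : Finset (Fin n) → E) (D : ℝ)
    (hD : 0 ≤ D)
    (hle : ∀ S T, #S = k → #T = k → dist (x S) (x T) ≤ D)
    (heq : ∀ S T, #S = k → #T = k → #(S ∩ T) = t → dist (x S) (x T) = D)
    (hP : HasBorsukPartition (x '' {S | #S = k}) m) :
    n.choose k ≤ m * n.choose (r ^ e - 1) := by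
  classical
  obtain ⟨P, hPU, -, hPd⟩ := hP
  have hbdd : Bornology.IsBounded (x '' {S | #S = k}) := (Set.toFinite _).isBounded
  have hdiam : Metric.diam (x '' {S | #S = k}) ≤ D := by
    refine Metric.diam_le_of_forall_dist_le hD ?_
    rintro _ ⟨S, hS, rfl⟩ _ ⟨T, hT, rfl⟩
    exact hle S T hS hT
  -- Sets are collected rather than points, so `x` need not be injective.
  let F (i : Fin m) : Finset (Finset (Fin n)) := {S ∈ powersetCard k univ | x S ∈ P i}
  have hcover : powersetCard k (univ : Finset (Fin n)) ⊆ univ.biUnion F := by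
    intro S hS
    have hxS : x S ∈ ⋃ i, P i := hPU ▸ ⟨S, (mem_powersetCard.1 hS).2, rfl⟩
    obtain ⟨i, hi⟩ := Set.mem_iUnion.1 hxS
    exact mem_biUnion.2 ⟨i, mem_univ i, mem_filter.2 ⟨hS, hi⟩⟩
  have hF (i : Fin m) : #(F i) ≤ n.choose (r ^ e - 1) := by
    have hcard : ∀ S ∈ F i, #S = k := fun S hS => (mem_powersetCard.1 (mem_filter.1 hS).1).2
    have h := card_le_choose_of_inter_ne hr hkt ht (F i) hcard fun S hS T hT hST => ?_
    · rwa [Fintype.card_fin] at h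
    · have h1 := heq S T (hcard S hS) (hcard T hT) hST
      have h2 := Metric.dist_le_diam_of_mem
        (hbdd.subset (hPU ▸ Set.subset_iUnion P i)) (mem_filter.1 hS).2 (mem_filter.1 hT).2
      linarith [hPd i]
  calc n.choose k = #(powersetCard k (univ : Finset (Fin n))) := by simp
    _ ≤ #(univ.biUnion F) := card_le_card hcover
    _ ≤ #(univ : Finset (Fin m)) * n.choose (r ^ e - 1) :=
        card_biUnion_le_card_mul _ _ _ fun i _ => hF i
    _ = m * n.choose (r ^ e - 1) := by rw [card_univ, Fintype.card_fin]

theorem hasBorsukPartition_borsukNumber {E : Type*} [NormedAddCommGroup E] [NormedSpace ℝ E]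
    [FiniteDimensional ℝ E] {A : Set E} (hA : Bornology.IsBounded A) (hA' : A.Nontrivial) :
    HasBorsukPartition A (borsukNumber E) :=
  Nat.sInf_mem (exists_hasBorsukPartition E) A hA hA'

theorem choose_le_borsukNumberLp_mul {n k t r e : ℕ} {p mu : ℝ} (hp : 1 ≤ p)
    (hmu : -1 / 2 ≤ mu) (hmu' : mu ≤ 0) (hr : r.Prime) (hkt : k = t + r ^ e) (ht0 : 0 < t)
    (ht : t < r ^ e) (hn : 2 * k ≤ n) (hnear : |(t : ℝ) - tZero mu p n k| ≤ 1 / 2) :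
    n.choose k ≤ borsukNumberLp p hp (n.choose 2) * n.choose (r ^ e - 1) := by
  have : Fact (1 ≤ ENNReal.ofReal p) := ⟨ENNReal.one_le_ofReal.2 hp⟩
  have hp0 : 0 < p := by linarith
  have hpos : 0 < distQuadratic mu p n k t := distQuadratic_pos hmu hn (by omega) ht0
  have hD : 0 < (2 * distQuadratic mu p n k t) ^ (1 / p) :=
    Real.rpow_pos_of_pos (by linarith) _
  refine choose_le_mul_of_hasBorsukPartition hr hkt ht
    (setPoint mu (ENNReal.ofReal p)) ((2 * distQuadratic mu p n k t) ^ (1 / p)) hD.le ?_ ?_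
    (hasBorsukPartition_borsukNumber (Set.toFinite _).isBounded ?_)
  · intro S T hS hT
    have hnn : 0 ≤ 2 * distQuadratic mu p n k #(S ∩ T) := by
      have h := sum_abs_pairValue_sub_rpow (lam := mu) hp0.ne' hS hT
      rw [Fintype.card_fin] at h
      rw [← h]
      positivity
    rw [dist_setPoint hp0 mu hS hT]
    refine Real.rpow_le_rpow hnn ?_ (by positivity)
    linarith [distQuadratic_le (s := #(S ∩ T)) hp0.le hmu hmu' hnear]
  · intro S T hS hT hST
    rw [dist_setPoint hp0 mu hS hT, hST]
  -- Two sets meeting in `t` elements have positive distance, so the configuration has at least two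
  -- points.
  · obtain ⟨S, T, hS, hT, hST⟩ := exists_card_inter_eq (α := Fin n) (k := k) (t := t)
      (by omega) (by simpa using hn)
    refine ⟨_, ⟨S, hS, rfl⟩, _, ⟨T, hT, rfl⟩, dist_pos.1 ?_⟩
    rw [dist_setPoint hp0 mu hS hT, hST]
    exact hD

end Borsuk

theorem theorem1 (n k : ℕ) (p lam : ℝ) (hk : 1 < k) (hkn : (k : ℝ) < (n : ℝ) / 2)
    (hp : 1 ≤ p) (hlam : -1 / 2 ≤ lam) (hlam' : lam ≤ 0) (t₁ : ℤ)
    (ht₁ : IsGreatest {t : ℤ | t ≤ ⌊tZero lam p n k + 1 / 2⌋ ∧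
      ∃ q : ℕ, IsPrimePow q ∧ (k : ℤ) - t = (q : ℤ)} t₁)
    (ht₁_pos : 0 < t₁) (ht₁_lt : (t₁ : ℝ) < (k : ℝ) / 2) :
    (n.choose k : ℝ) / (n.choose ((k : ℤ) - t₁ - 1).toNat : ℝ) ≤
      (borsukNumberLp p hp (n.choose 2) : ℝ) := by
  obtain ⟨⟨hfloor, q, hq, hkq⟩, -⟩ := ht₁
  lift t₁ to ℕ using ht₁_pos.le with t
  obtain ⟨r, e, hr, -, rfl⟩ := hq
  -- With `k = t + r ^ e` this is the condition `t < r ^ e` of Frankl–Wilson.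
  have h2t : 2 * t < k := by
    have : (2 : ℝ) * t < k := by rw [Int.cast_natCast] at ht₁_lt; linarith
    exact_mod_cast this
  have h2k : 2 * k ≤ n := by
    have : (2 : ℝ) * k ≤ n := by linarith
    exact_mod_cast this
  have hle : (t : ℝ) ≤ tZero lam p n k + 1 / 2 := by
    simpa using Int.le_floor.1 hfloor
  obtain ⟨mu, hmu, hmu', hnear⟩ :=
    exists_abs_sub_tZero_le (by linarith) hlam hlam' (by omega) hle
  have hkt : k = t + r ^ e := by zify; push_cast at hkq; linarith
  have hmain := choose_le_borsukNumberLp_mul hp hmu hmu' hr.nat_prime hkt (by omega) (by omega)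
    h2k hnear
  have hidx : ((k : ℤ) - (t : ℤ) - 1).toNat = r ^ e - 1 := by omega
  rw [hidx]
  have hchoose : 0 < n.choose (r ^ e - 1) := Nat.choose_pos (by omega)
  rw [div_le_iff₀ (by exact_mod_cast hchoose)]
  exact_mod_cast hmain
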